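/- Let $\boldsymbol\tau=(\tau_t)_{t\in\mathbb N}$ be a directive sequence, i.e. $(A_t)_{t\in\mathbb N}$ are non-empty finite alphabets and each $\tau_t\colon A_{t+1}\to A_t^+$ assigns to every letter a non-empty word. Write $\tau_{[0,t)}=\tau_0\tau_1\cdots\tau_{t-1}$ for the composed substitution from $A_t$ to $A_0^+$. Assume: 1. $\boldsymbol\tau$ is preperiodic: there are $q\ge 0$ and $p\ge 1$ such that $A_{t+p}=A_t$ and $\tau_{t+p}=\tau_t$ for all $t\ge q$; 2. $\boldsymbol\tau$ is everywhere-growing: $\min_{a\in A_t}|\tau_{[0,t)}(a)|\to\infty$ as $t\to\infty$; 3. the limit set $\Omega_{\boldsymbol\tau}=\bigcap_{t\in\mathbb N}\tau_{[0,t)}(A_t^{\mathbb Z})$ contains no point that is periodic for the shift map $\sigma$, $\sigma(x)_i=x_{i+1}$. Here $\tau_{[0,t)}(A_t^{\mathbb Z})$ is the set of $x\in A_0^{\mathbb Z}$ for which there are $y\in A_t^{\mathbb Z}$ and an increasing sequence $(k_s)_{s\in\mathbb Z}$ of integers with $x_{k_s}x_{k_s+1}\cdots x_{k_{s+1}-1}=\tau_{[0,t)}(y_s)$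 for all $s\in\mathbb Z$. Then the dynamical system $(\Omega_{\boldsymbol\tau},\sigma)$ is finitely positively expansive: for every metric $d$ on $\Omega_{\boldsymbol\tau}$ inducing the topology inherited from the product topology of $A_0^{\mathbb Z}$ (with $A_0$ discrete), there are an integer $n\ge 1$ and $\varepsilon>0$ such that for every $x\in\Omega_{\boldsymbol\tau}$ the set $\{y\in\Omega_{\boldsymbol\tau} : d(\sigma^t(x),\sigma^t(y))<\varepsilon \text{ for all } t\in\mathbb N\}$ has at most $n$ elements. -/

import Mathlib

open Filter

/-! Positive expansiveness of a self-map of a metric space. -/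

/-- `W_ε(x)`: the points whose forward orbit stays at distance `< ε` from that of `x`. -/
def dynamicalBall {X : Type*} [MetricSpace X] (f : X → X) (ε : ℝ) (x : X) : Set X :=
  {y | ∀ t : ℕ, dist (f^[t] x) (f^[t] y) < ε}

/-- `(X, f)` is positively `n`-expansive with constant `ε`. -/
def IsPositivelyExpansiveWith {X : Type*} [MetricSpace X] (f : X → X) (n : ℕ) (ε : ℝ) : Prop :=
  ∀ x : X, (dynamicalBall f ε x).encard ≤ n

/-- `(X, f)` is finitely positively expansive. -/
def IsFinitelyPositivelyExpansive {X : Type*} [MetricSpace X] (f : X → X) : Prop :=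
  ∃ n : ℕ, 1 ≤ n ∧ ∃ ε : ℝ, 0 < ε ∧ IsPositivelyExpansiveWith f n ε

/-! Two-sided configurations, the shift, desubstitutions. -/

/-- The shift action on two-sided configurations: `σ(x)_i = x_{i+1}`. -/
def shift {α : Type*} (x : ℤ → α) : ℤ → α := fun i => x (i + 1)

/-- The finite word `x_i x_{i+1} ⋯ x_{j-1}` (empty if `j ≤ i`). -/
def factorWord {α : Type*} (x : ℤ → α) (i j : ℤ) : List α :=
  (List.range (j - i).toNat).map fun n => x (i + n)

/-- The cutting points `k` and the configuration `y` are a desubstitution scheme and the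
corresponding desubstitution of `x` for `w`: `k` is increasing and
`x_{[k_s, k_{s+1})} = w(y_s)` for every `s`. -/
def IsDesubstitution {α : Type*} (w : α → List α) (x : ℤ → α) (k : ℤ → ℤ) (y : ℤ → α) : Prop :=
  StrictMono k ∧ ∀ s : ℤ, factorWord x (k s) (k (s + 1)) = w (y s)

/-! Directive sequences. -/

/-- A directive sequence: non-empty finite alphabets `A_t` (inside some set of symbols `α`) and
non-erasing substitutions `τ_t : A_{t+1} → A_t⁺`. The map `subst t` is written as a total function
on symbols; only its values on `A_{t+1}` matter. -/
structure DirectiveSequence (α : Type*) where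
  alphabet : ℕ → Finset α
  alphabet_nonempty : ∀ t, (alphabet t).Nonempty
  subst : ℕ → α → List α
  subst_ne_nil : ∀ t, ∀ a ∈ alphabet (t + 1), subst t a ≠ []
  subst_mem : ∀ t, ∀ a ∈ alphabet (t + 1), ∀ b ∈ subst t a, b ∈ alphabet t

namespace DirectiveSequence

variable {α : Type*} (τ : DirectiveSequence α)

/-- The composed substitution `τ_{[0,t)} = τ_0 τ_1 ⋯ τ_{t-1}`, a map from `A_t` to `A_0⁺`;
for `t = 0` it is the identity substitution. -/
def comp : ℕ → α → List α
  | 0, a => [a]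
  | t + 1, a => (τ.subst t a).flatMap (comp t)

/-- The minimal length `|τ_{[0,t)}|`, the minimum of `|τ_{[0,t)}(a)|` over `a ∈ A_t`. -/
def minLength (t : ℕ) : ℕ :=
  (τ.alphabet t).inf' (τ.alphabet_nonempty t) fun a => (τ.comp t a).length

/-- The minimal lengths `|τ_{[0,t)}|` tend to infinity. -/
def EverywhereGrowing : Prop := Tendsto τ.minLength atTop atTop

/-- The sequence `(τ_t)` of substitutions is preperiodic: from some rank on it is periodic
(alphabets included). -/
def IsPreperiodic : Prop :=
  ∃ q p : ℕ, 1 ≤ p ∧ ∀ t, q ≤ t →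
    τ.alphabet (t + p) = τ.alphabet t ∧
      ∀ a ∈ τ.alphabet (t + 1), τ.subst (t + p) a = τ.subst t a

/-- The S-adic limit set `Ω_τ = ⋂_t τ_{[0,t)}(A_t^ℤ)`: the configurations which, for every `t`,
admit a desubstitution in `A_t^ℤ` for `τ_{[0,t)}`. -/
def limitSet : Set (ℤ → α) :=
  {x | ∀ t : ℕ, ∃ (k : ℤ → ℤ) (y : ℤ → α),
    (∀ s, y s ∈ τ.alphabet t) ∧ IsDesubstitution (τ.comp t) x k y}

theorem shift_mapsTo : Set.MapsTo shift τ.limitSet τ.limitSet := by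
  intro x hx t
  obtain ⟨k, y, hy, hk, h⟩ := hx t
  refine ⟨fun s => k s - 1, y, hy, fun a b hab => by simpa using hk hab, fun s => ?_⟩
  rw [← h s]
  simp only [factorWord, shift]
  rw [show k (s + 1) - 1 - (k s - 1) = k (s + 1) - k s by ring]
  refine List.map_congr_left fun n _ => ?_
  congr 1
  ring

/-- The shift action restricted to the limit set. -/
def shiftMap : τ.limitSet → τ.limitSet := τ.shift_mapsTo.restrict

end DirectiveSequence

/-!
The limit set `Ω` is compact, so for every admissible metric there is an `ε > 0` such that points
at distance `< ε` have the same letter at `0` (`exists_dist_lt_imp_eq`). A point of the dynamical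
ball of `x` then agrees with `x` on `[0, ∞)`, and it suffices to bound the number of points of `Ω`
with a given right half. Preperiodicity bounds the sizes of the alphabets by some `K`; for every
`t`, each point of `Ω` is a concatenation of at most `K` words, whose lengths grow with `t`.
Compactness and the absence of periodic points bound, for each `p`, the length of the intervals on
which a point of `Ω` has period `p` (`DirectiveSequence.exists_noRun`).

The bound is a statement on words (`TiledFamily.exists_card_bound`), proved by induction on the
number of words. Suppose that many configurations agree on `[0, R)`, differ pairwise on `[-m, 0)`,
and are concatenations of few words, all very long compared with `m`. By the pigeonhole principle
many of them have the same word `v` over `[-m, 0)`, ending at distinct positions `E 0 < E 1 < ⋯`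
(`BranchingFamily`). So the common right half `u` starts with the last `E i` letters of `v`, for
each `i`, and `v` overlaps itself in many ways. If `u` had a period on an interval which
reaches three such ends, then two of the configurations would coincide on `[-m, 0)`
(`BranchingFamily.not_periodic`). Hence the `E i` grow exponentially (`BranchingFamily.gap`), and
no long word occurs at two different places near the beginning of `u`
(`BranchingFamily.not_occurs_twice`).

Choose a long range of indices for which no word length lies between the corresponding `E i`, so
that each word is short or long with respect to this range. The first long words after the
position `E i`, for different `i`, cannot all be near `E i`, since two equal ones would occur at
different places. So for some `i` only short words are used from `E i` up to a much later `E k`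
(`BranchingFamily.exists_short_tiling`). But `u` up to `E k` is the end of `v`, so that this piece
of `v` is a concatenation of short words, and it covers the surroundings of the origin in all
configurations with indices between `i` and `k`, up to a few
(`BranchingFamily.tiles_of_short_tiling`). The word `v` is not short, and the induction hypothesis
applies to the short words.
-/

/-! ### Tilings of intervals by words -/

/-- The word `w` occurs in the configuration `y` at position `a`. -/
def Occurs {α : Type*} (w : List α) (y : ℤ → α) (a : ℤ) : Prop :=
  ∀ (n : ℕ) (h : n < w.length), y (a + n) = w[n]

/-- The interval `[a, b)` of the configuration `y` is cut into consecutive occurrences of words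
of `W`. -/
inductive Tiles {α : Type*} (W : Finset (List α)) (y : ℤ → α) : ℤ → ℤ → Prop
  | nil (a : ℤ) : Tiles W y a a
  | cons {a b : ℤ} (w : List α) (hw : w ∈ W) (ho : Occurs w y a)
      (ht : Tiles W y (a + w.length) b) : Tiles W y a b

/-- No interval of length `L` of `y` (extended by `p` to the right) has period `p`. -/
def NoRun {α : Type*} (y : ℤ → α) (p L : ℤ) : Prop :=
  ∀ a, ¬ ∀ x, a ≤ x → x < a + L → y x = y (x + p)

section Tiles

variable {α : Type*} {W : Finset (List α)} {y : ℤ → α}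

theorem Occurs.eq_of_occurs {w : List α} {y y' : ℤ → α} {a a' : ℤ} (h : Occurs w y a)
    (h' : Occurs w y' a') {x : ℤ} (h0 : 0 ≤ x) (hx : x < w.length) : y (a + x) = y' (a' + x) := by
  lift x to ℕ using h0
  have hx' : x < w.length := by exact_mod_cast hx
  rw [h x hx', h' x hx']

theorem Occurs.shift_eq {w : List α} {y y' : ℤ → α} {a a' : ℤ} (h : Occurs w y a)
    (h' : Occurs w y' a') {x : ℤ} (h0 : a ≤ x) (hx : x < a + w.length) :
    y x = y' (x + (a' - a)) := by
  have := h.eq_of_occurs h' (x := x - a) (by omega) (by omega)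
  rw [show a + (x - a) = x by ring, show a' + (x - a) = x + (a' - a) by ring] at this
  exact this

theorem Tiles.le {a b : ℤ} (h : Tiles W y a b) : a ≤ b := by
  induction h with
  | nil => exact le_rfl
  | cons w _ _ _ ih => omega

/-- The tile containing a given position. -/
theorem Tiles.exists_tile {a b p : ℤ} (h : Tiles W y a b) (hap : a ≤ p) (hpb : p < b) :
    ∃ s, ∃ w ∈ W, Occurs w y s ∧ s ≤ p ∧ p < s + w.length ∧ Tiles W y (s + w.length) b := by
  induction h with
  | nil => omega
  | @cons a b w hw ho ht ih =>
    by_cases hp : p < a + w.length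
    · exact ⟨a, w, hw, ho, hap, hp, ht⟩
    · exact ih (by omega) hpb

/-- Either a tiling starts with tiles from `S` that reach the position `t`, or some tile outside
`S` begins before `t` and is preceded by tiles from `S` only. -/
theorem Tiles.exists_first_not_mem [DecidableEq (List α)] (S : Finset (List α)) {a b t : ℤ}
    (h : Tiles W y a b) (htb : t ≤ b) :
    (∃ c, t ≤ c ∧ Tiles S y a c) ∨ ∃ e, a ≤ e ∧ e < t ∧ ∃ w ∈ W, w ∉ S ∧ Occurs w y e := by
  induction h with
  | nil a => exact .inl ⟨a, htb, .nil a⟩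
  | @cons a b w hw ho ht ih =>
    by_cases hta : t ≤ a
    · exact .inl ⟨a, hta, .nil a⟩
    by_cases hS : w ∈ S
    · rcases ih htb with ⟨c, hc, hT⟩ | ⟨e, he, het, w', hw', hS', ho'⟩
      · exact .inl ⟨c, hc, .cons w hS ho hT⟩
      · exact .inr ⟨e, by omega, het, w', hw', hS', ho'⟩
    · exact .inr ⟨a, le_rfl, by omega, w, hw, hS, ho⟩

/-- The last cut of a tiling before a given position. -/
theorem Tiles.exists_truncate {M a b t : ℤ} (h : Tiles W y a b) (hM : 0 < M)
    (hW : ∀ w ∈ W, (w.length : ℤ) ≤ M) (hat : a ≤ t) (htb : t ≤ b) :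
    ∃ c, Tiles W y a c ∧ c ≤ t ∧ t < c + M := by
  induction h with
  | nil a => exact ⟨a, .nil a, hat, by omega⟩
  | @cons a b w hw ho ht ih =>
    by_cases hp : t < a + w.length
    · exact ⟨a, .nil a, hat, by have := hW w hw; omega⟩
    · obtain ⟨c, hc, h1, h2⟩ := ih (by omega) htb
      exact ⟨c, .cons w hw ho hc, h1, h2⟩

theorem Tiles.transport {y' : ℤ → α} {a b d : ℤ} (h : Tiles W y a b)
    (hy : ∀ x, a ≤ x → x < b → y' (x + d) = y x) : Tiles W y' (a + d) (b + d) := by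
  induction h with
  | nil a => exact .nil _
  | @cons a b w hw ho ht ih =>
    refine .cons w hw (fun n hn => ?_) ?_
    · have := ht.le
      rw [← ho n hn, ← hy (a + n) (by omega) (by omega)]
      congr 1; ring
    · rw [show a + d + (w.length : ℤ) = a + w.length + d by ring]
      exact ih fun x h1 h2 => hy x (by omega) h2

end Tiles

/-! ### Branching families with a common block -/

/-- A family of configurations `Y i`, `i < n`, which agree on `[0, R)`, differ pairwise on
`[-m, 0)`, and in each of which the interval `[-m, 0)` is covered by an occurrence of one and the
same word of length `l`. This occurrence ends at position `E i`, and from there on `Y i` is tiled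
by words of `W`. -/
structure BranchingFamily {α : Type*} (W : Finset (List α)) (m l R : ℤ) (n : ℕ)
    (E : ℕ → ℤ) (Y : ℕ → ℤ → α) : Prop where
  mono : ∀ i j, i < j → j < n → E i < E j
  lt_end : ∀ i < n, m < E i
  end_le : ∀ i < n, E i + m ≤ l
  le_range : l ≤ R
  common : ∀ i < n, ∀ j < n, ∀ x, 1 ≤ x → x ≤ l → Y i (E i - x) = Y j (E j - x)
  agree : ∀ i < n, ∀ j < n, ∀ x, 0 ≤ x → x < R → Y i x = Y j x
  differ : ∀ i < n, ∀ j < n, i ≠ j → ∃ x, -m ≤ x ∧ x < 0 ∧ Y i x ≠ Y j x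
  tiles : ∀ i < n, ∃ b, R ≤ b ∧ Tiles W (Y i) (E i) b

namespace BranchingFamily

variable {α : Type*} {W : Finset (List α)} {m l R : ℤ} {n : ℕ} {E : ℕ → ℤ} {Y : ℕ → ℤ → α}

/-- The common part of the family is not periodic on an interval `[A, B)` that reaches the ends of
three of the common blocks: the pasts of two of the members would coincide. -/
theorem not_periodic (hB : BranchingFamily W m l R n E Y) (hm : 1 ≤ m) {ℓ : ℤ}
    (hrun : ∀ i < n, ∀ p, 1 ≤ p → p < m → NoRun (Y i) p ℓ)
    {i j k : ℕ} (hij : i < j) (hj : j < n) (hk : k < n) {p A B : ℤ}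
    (hA : 0 ≤ A) (hp : 1 ≤ p) (hpi : p ≤ E i) (hjk : m ≤ p → E j + m ≤ E k - A)
    (hkB : E k ≤ B) (hAB : ℓ ≤ B - p - A)
    (hper : ∀ x, A ≤ x → x + p < B → Y k x = Y k (x + p)) : False := by
  rcases lt_or_ge p m with hpm | hpm
  · exact hrun k hk p hp hpm A fun x h1 h2 => hper x h1 (by omega)
  have hi : i < n := hij.trans hj
  have hEij := hB.mono i j hij hj
  have hjk := hjk hpm
  have := hB.end_le i hi
  have := hB.end_le j hj
  have := hB.end_le k hk
  obtain ⟨x, hx1, hx2, hne⟩ := hB.differ i hi j hj hij.ne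
  apply hne
  -- Read backwards from its end, the common block carries the past of `Y i` after `E i` letters and
  -- that of `Y j` after `E j` letters. It has period `p` up to `E j + m`, and it repeats under the
  -- shift by `E j - E i` up to `E i`: go back by `p`, shift, and return by `p`.
  calc Y i x = Y i (E i - (E i - x)) := by congr 1; ring
    _ = Y k (E k - (E i - x)) := hB.common i hi k hk _ (by omega) (by omega)
    _ = Y k (E k - (E i - x) + p) := hper _ (by omega) (by omega)
    _ = Y k (E k - (E i - x - p)) := by congr 1; ring
    _ = Y i (E i - (E i - x - p)) := hB.common k hk i hi _ (by omega) (by omega)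
    _ = Y j (E i - (E i - x - p)) := hB.agree i hi j hj _ (by omega) (by
        have := hB.le_range; omega)
    _ = Y j (E j - (E j - x - p)) := by congr 1; ring
    _ = Y k (E k - (E j - x - p)) := hB.common j hj k hk _ (by omega) (by omega)
    _ = Y k (E k - (E j - x) + p) := by congr 1; ring
    _ = Y k (E k - (E j - x)) := (hper _ (by omega) (by omega)).symm
    _ = Y j (E j - (E j - x)) := hB.common k hk j hj _ (by omega) (by omega)
    _ = Y j x := by congr 1; ring

/-- The ends of the common blocks form a lacunary sequence. -/
theorem gap (hB : BranchingFamily W m l R n E Y) (hm : 1 ≤ m) {ℓ : ℤ} (hℓ : ∀ i < n, ℓ ≤ E i)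
    (hrun : ∀ i < n, ∀ p, 1 ≤ p → p < m → NoRun (Y i) p ℓ)
    {i j k : ℕ} (hij : i < j) (hjk : j < k) (hk : k < n) : E i + E j < E k := by
  by_contra! hle
  have hj := hjk.trans hk
  have h1 := hB.mono j k hjk hk
  have h2 := hℓ j hj
  have h3 := hB.end_le k hk
  have h4 := hB.lt_end j hj
  have h5 := hB.le_range
  -- Two of the common blocks shifted by `E k - E j` against each other give this period.
  refine hB.not_periodic hm hrun hij hj hk (p := E k - E j) (A := 0) (B := E k) le_rfl (by omega)
    (by omega) (by omega) le_rfl (by omega) fun x hx0 hx => ?_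
  calc Y k x = Y j x := hB.agree k hk j hj x hx0 (by omega)
    _ = Y j (E j - (E j - x)) := by congr 1; ring
    _ = Y k (E k - (E j - x)) := hB.common j hj k hk _ (by omega) (by omega)
    _ = Y k (x + (E k - E j)) := by congr 1; ring

/-- A word that is long compared with the ends of the common blocks does not occur at two
different places of the common part. -/
theorem not_occurs_twice (hB : BranchingFamily W m l R n E Y) (hm : 1 ≤ m) {ℓ : ℤ}
    (hℓ : ∀ i < n, ℓ ≤ E i)
    (hrun : ∀ i < n, ∀ p, 1 ≤ p → p < m → NoRun (Y i) p ℓ)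
    {a i j : ℕ} (ha : a + 3 < n) (hi : i < n) (hj : j < n) {w : List α} {e e' : ℤ}
    (he0 : 0 ≤ e) (hee : e < e') (hea : e' ≤ E a) (hw : E (a + 3) ≤ w.length)
    (hR : E a + w.length ≤ R) (ho : Occurs w (Y i) e) (ho' : Occurs w (Y j) e') : False := by
  have h1 := hB.gap hm hℓ hrun (i := a + 1) (j := a + 2) (k := a + 3) (by omega) (by omega) ha
  have h2 := hB.gap hm hℓ hrun (i := a) (j := a + 1) (k := a + 2) (by omega) (by omega) (by omega)
  have h3 := hB.lt_end (a + 1) (by omega)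
  have h4 := hℓ (a + 3) ha
  refine hB.not_periodic hm hrun (i := a) (j := a + 1) (k := a + 3) (by omega) (by omega) ha
    (p := e' - e) (A := e) (B := e' + w.length) he0 (by omega) (by omega) (by omega) (by omega)
    (by omega) fun x h5 h6 => ?_
  rw [hB.agree (a + 3) ha i hi x (by omega) (by omega), ho.shift_eq ho' h5 (by omega)]
  exact hB.agree j hj _ ha _ (by omega) (by omega)

/-- Consecutive members of a branching family form a branching family. -/
theorem window (hB : BranchingFamily W m l R n E Y) (i₀ n' : ℕ) (h : i₀ + n' ≤ n) :
    BranchingFamily W m l R n' (fun i => E (i₀ + i)) (fun i => Y (i₀ + i)) where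
  mono i j hij hj := hB.mono _ _ (by omega) (by omega)
  lt_end i hi := hB.lt_end _ (by omega)
  end_le i hi := hB.end_le _ (by omega)
  le_range := hB.le_range
  common i hi j hj := hB.common _ (by omega) _ (by omega)
  agree i hi j hj := hB.agree _ (by omega) _ (by omega)
  differ i hi j hj hij := hB.differ _ (by omega) _ (by omega) (by omega)
  tiles i hi := hB.tiles _ (by omega)

theorem mono_le (hB : BranchingFamily W m l R n E Y) {i j : ℕ} (hij : i ≤ j) (hj : j < n) :
    E i ≤ E j := by
  rcases hij.eq_or_lt with rfl | h
  · exact le_rfl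
  · exact (hB.mono i j h hj).le

/-- If every word of `W` is either short or long compared with all ends of the common blocks, then
the tiling of some member continues, after the common block, with short words only until the end
of a much later common block. Otherwise the first long words in sufficiently many members start
at different positions, and two of these words coincide. -/
theorem exists_short_tiling [DecidableEq (List α)] {K r : ℕ}
    (hB : BranchingFamily W m l R n E Y) (hn : n = (K + 1) * r + 4) (hm : 1 ≤ m) {ℓ : ℤ}
    (hℓ : ∀ i < n, ℓ ≤ E i) (hrun : ∀ i < n, ∀ p, 1 ≤ p → p < m → NoRun (Y i) p ℓ)
    (hK : W.card ≤ K) (hW : ∀ w ∈ W, (w.length : ℤ) ≤ E 0 ∨ E (n - 1) ≤ w.length)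
    (hR : ∀ w ∈ W, l + w.length ≤ R) :
    ∃ i, i + r ≤ (K + 1) * r ∧ ∃ c, E (i + r) ≤ c ∧
      Tiles (W.filter fun w => (w.length : ℤ) ≤ E 0) (Y i) (E i) c := by
  by_contra! hcon
  have key : ∀ s : Fin (K + 1), ∃ w ∈ W, E (n - 1) ≤ w.length ∧
      ∃ e, E (s * r) ≤ e ∧ e < E ((s + 1) * r) ∧ Occurs w (Y (s * r)) e := by
    intro s
    have hs : ((s : ℕ) + 1) * r ≤ (K + 1) * r := Nat.mul_le_mul_right _ (by omega)
    have hs' : (s : ℕ) * r + r = (s + 1) * r := by ring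
    obtain ⟨b, hb, ht⟩ := hB.tiles (s * r) (by omega)
    have h1 := hB.end_le ((s + 1) * r) (by omega)
    have h2 := hB.le_range
    rcases ht.exists_first_not_mem (W.filter fun w => (w.length : ℤ) ≤ E 0)
      (t := E ((s + 1) * r)) (by omega) with ⟨c, hc, hT⟩ | ⟨e, h3, h4, w, hw, hS, ho⟩
    · exact absurd hT (hcon _ (by omega) c (by rwa [hs']))
    · refine ⟨w, hw, ?_, e, h3, h4, ho⟩
      rcases hW w hw with h | h
      · exact absurd (Finset.mem_filter.2 ⟨hw, h⟩) hS
      · exact h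
  choose w hw hlen e he1 he2 ho using key
  obtain ⟨s, -, s', -, hss, hww⟩ := Finset.exists_ne_map_eq_of_card_lt_of_maps_to
    (s := Finset.univ) (t := W) (f := w) (by simpa using Nat.lt_succ_of_le hK)
    (fun s _ => hw s)
  have main : ∀ s s' : Fin (K + 1), s < s' → w s = w s' → False := by
    intro s s' hlt hww
    have hlt' : (s : ℕ) < s' := hlt
    have h1 : ((s : ℕ) + 1) * r ≤ s' * r := Nat.mul_le_mul_right _ (by omega)
    have h2 : ((s' : ℕ) + 1) * r ≤ (K + 1) * r := Nat.mul_le_mul_right _ (by omega)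
    have h3 : (s' : ℕ) * r ≤ (s' + 1) * r := Nat.mul_le_mul_right _ (by omega)
    have h3' : (s : ℕ) * r ≤ (s + 1) * r := Nat.mul_le_mul_right _ (by omega)
    have h4 := hB.mono_le h1 (by omega)
    have h5 := hB.mono_le h2 (by omega)
    have h6 := hB.lt_end (s * r) (by omega)
    have h7 := he1 s
    have h8 := he2 s
    have h9 := he1 s'
    have h10 := he2 s'
    have h11 := hlen s
    rw [show n - 1 = (K + 1) * r + 3 by omega] at h11
    have h12 := hB.end_le ((K + 1) * r) (by omega)
    have h13 := hR _ (hw s)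
    exact hB.not_occurs_twice hm hℓ hrun (a := (K + 1) * r) (i := s * r) (j := s' * r)
      (w := w s) (e := e s) (e' := e s') (by omega) (by omega) (by omega) (by omega) (by omega)
      (by omega) h11 (by omega) (ho s) (hww ▸ ho s')
  rcases lt_or_gt_of_ne hss with h | h
  · exact main s s' h hww
  · exact main s' s h hww.symm

/-- A tiling by short words to the right of one common block is, by self-overlap, a tiling of the
common block itself; this tiles the other members around the origin. -/
theorem tiles_of_short_tiling {S : Finset (List α)} (hB : BranchingFamily W m l R n E Y)
    (hm : 1 ≤ m) {ℓ : ℤ} (hℓ : ∀ i < n, ℓ ≤ E i)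
    (hrun : ∀ i < n, ∀ p, 1 ≤ p → p < m → NoRun (Y i) p ℓ)
    {i k : ℕ} (hk : k < n) {c : ℤ} (hc : E k ≤ c) (ht : Tiles S (Y i) (E i) c)
    (hS : ∀ w ∈ S, (w.length : ℤ) ≤ E 0) {j : ℕ} (hij : i + 3 ≤ j) (hjk : j + 2 ≤ k) :
    ∃ a b, a ≤ -m ∧ 2 * E 0 ≤ b ∧ Tiles S (Y j) a b := by
  have h0 := hB.lt_end 0 (by omega)
  have hik := hB.mono_le (i := i) (j := k) (by omega) hk
  obtain ⟨c', ht', hc1, hc2⟩ := ht.exists_truncate (M := E 0) (by omega) hS hik hc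
  have h0i := hB.mono_le (i := 0) (j := i) (by omega) (by omega)
  have g1 := hB.gap hm hℓ hrun (i := i) (j := i + 1) (k := i + 2) (by omega) (by omega) (by omega)
  have g2 := hB.gap hm hℓ hrun (i := i + 1) (j := i + 2) (k := i + 3) (by omega) (by omega)
    (by omega)
  have g3 := hB.mono_le hij (by omega)
  have g4 := hB.mono i (i + 1) (by omega) (by omega)
  have g5 := hB.gap hm hℓ hrun (i := j) (j := j + 1) (k := j + 2) (by omega) (by omega) (by omega)
  have g6 := hB.mono_le hjk hk
  have g7 := hB.gap hm hℓ hrun (i := i) (j := i + 1) (k := j + 1) (by omega) (by omega) (by omega)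
  have g8 := hB.lt_end (i + 1) (by omega)
  have g9 := hB.end_le k hk
  have g10 := hB.le_range
  have g11 := hB.lt_end i (by omega)
  refine ⟨E i + (E j - E k), c' + (E j - E k), by omega, by omega, ht'.transport fun x h1 h2 => ?_⟩
  calc Y j (x + (E j - E k)) = Y j (E j - (E k - x)) := by congr 1; ring
    _ = Y k (E k - (E k - x)) := hB.common j (by omega) k hk _ (by omega) (by omega)
    _ = Y k x := by congr 1; ring
    _ = Y i x := hB.agree k hk i (by omega) x (by omega) (by omega)

end BranchingFamily

/-! ### The bound for tiled families -/

/-- A function with values in `{0, …, K}` which is monotone along the multiples of `r` is constant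
on one of the first `K + 1` steps. -/
theorem exists_step_eq {f : ℕ → ℕ} {K r : ℕ} (hf : ∀ s ≤ K, f (s * r) ≤ f ((s + 1) * r))
    (hK : f ((K + 1) * r) ≤ K) : ∃ s ≤ K, f (s * r) = f ((s + 1) * r) := by
  by_contra! h
  have : ∀ s ≤ K + 1, s ≤ f (s * r) := by
    intro s
    induction s with
    | zero => simp
    | succ s ih =>
      intro hs
      have := ih (by omega)
      have := hf s (by omega)
      have := h s (by omega)
      omega
  have := this (K + 1) le_rfl
  omega

/-- The family `F` of configurations is tiled by `W` around the origin: its members agree on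
`[0, R)`, differ pairwise on `[-m, 0)`, and have tilings by words of `W` that cover `[-m, R)`. The
words of `W` have length at least `h + m`, and short periods do not persist: periods below `m`
not along intervals of length `ℓ`, and periods up to `ℓ + m` not along intervals of length `h`. -/
structure TiledFamily {α : Type*} (W : Finset (List α)) (m ℓ h H R : ℤ)
    (F : Finset (ℤ → α)) : Prop where
  one_le : 1 ≤ m
  m_le : m ≤ ℓ
  ℓ_le : ℓ ≤ h
  H_pos : 0 < H
  le_length : ∀ w ∈ W, h + m ≤ w.length
  length_le : ∀ w ∈ W, (w.length : ℤ) ≤ H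
  le_range : 2 * H ≤ R
  noRun : ∀ y ∈ F, ∀ p, 1 ≤ p → p < m → NoRun y p ℓ
  noRun' : ∀ y ∈ F, ∀ p, 1 ≤ p → p ≤ ℓ + m → NoRun y p h
  agree : ∀ y ∈ F, ∀ y' ∈ F, ∀ x, 0 ≤ x → x < R → y x = y' x
  differ : ∀ y ∈ F, ∀ y' ∈ F, y ≠ y' → ∃ x, -m ≤ x ∧ x < 0 ∧ y x ≠ y' x
  tiles : ∀ y ∈ F, ∃ a b, a ≤ -m ∧ R ≤ b ∧ Tiles W y a b

namespace TiledFamily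

variable {α : Type*} {W : Finset (List α)} {m ℓ h H R : ℤ} {F : Finset (ℤ → α)}

/-- In two members for which the tile over `-m` and its successor are the same words, the tiles
over `-m` begin at different positions, since together the two tiles cover `[-m, 0)`. -/
theorem end_ne (hT : TiledFamily W m ℓ h H R F) {y y' : ℤ → α} (hy : y ∈ F) (hy' : y' ∈ F)
    (hne : y ≠ y') {v w : List α} (hw : w ∈ W) {s s' : ℤ}
    (hv : Occurs v y s) (hv' : Occurs v y' s') (hs : s ≤ -m)
    (hwo : Occurs w y (s + v.length)) (hwo' : Occurs w y' (s' + v.length))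
    (hsv : -m < s + v.length) : s ≠ s' := by
  rintro rfl
  obtain ⟨x, hx1, hx2, hx⟩ := hT.differ y hy y' hy' hne
  apply hx
  have h1 := hT.le_length w hw
  have h2 := hT.ℓ_le
  have h3 := hT.m_le
  have h4 := hT.one_le
  rcases lt_or_ge x (s + v.length) with hlt | hge
  · simpa using hv.shift_eq hv' (x := x) (by omega) hlt
  · simpa using hwo.shift_eq hwo' hge (by omega)

/-- If the same word begins, in two members, at `e < e'`, then `e'` exceeds `ℓ`: otherwise `e' - e`
would be a small period of the common part over the length of this word. -/
theorem end_gt (hT : TiledFamily W m ℓ h H R F) {y y' : ℤ → α} (hy : y ∈ F) (hy' : y' ∈ F)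
    {w : List α} (hw : w ∈ W) {e e' : ℤ} (hwo : Occurs w y e) (hwo' : Occurs w y' e')
    (he : -m < e) (hee : e < e') : ℓ < e' := by
  by_contra! hle
  have h1 := hT.le_length w hw
  have h2 := hT.ℓ_le
  have h3 := hT.m_le
  have h4 := hT.one_le
  have h5 := hT.length_le w hw
  have h6 := hT.le_range
  refine hT.noRun' y' hy' (e' - e) (by omega) (by omega) (max 0 e) fun x hx1 hx2 => ?_
  rw [← hwo.shift_eq hwo' (by omega) (by omega)]
  exact hT.agree _ hy' _ hy x (by omega) (by omega)

/-- A large tiled family contains a large branching family: among the members which have the same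
two words at and after `-m`, all but at most one have the first of them end beyond `ℓ`. -/
theorem exists_branchingFamily (hT : TiledFamily W m ℓ h H R F) {n : ℕ}
    (hF : W.card * W.card * n < F.card) :
    ∃ v ∈ W, ∃ E Y, BranchingFamily W m v.length R n E Y ∧ (∀ i < n, Y i ∈ F) ∧
      ∀ i < n, ℓ < E i := by
  classical
  have h1 := hT.ℓ_le
  have h2 := hT.m_le
  have h3 := hT.one_le
  have h4 := hT.le_range
  have h5 := hT.H_pos
  have key : ∀ y ∈ F, ∃ v ∈ W, ∃ w ∈ W, ∃ s b, Occurs v y s ∧ s ≤ -m ∧ -m < s + v.length ∧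
      Occurs w y (s + v.length) ∧ R ≤ b ∧ Tiles W y (s + v.length) b := by
    intro y hy
    obtain ⟨a, b, ha, hb, ht⟩ := hT.tiles y hy
    obtain ⟨s, v, hv, ho, hs, hs', ht'⟩ := ht.exists_tile (p := -m) ha (by omega)
    have h6 := hT.length_le v hv
    cases ht' with
    | nil => omega
    | cons w hw ho' ht'' => exact ⟨v, hv, w, hw, s, b, ho, hs, hs', ho', hb, .cons w hw ho' ht''⟩
  choose! v hv w hw s b hvo hs hsv hwo hb ht using key
  obtain ⟨⟨v₀, w₀⟩, hvw, hG⟩ := Finset.exists_lt_card_fiber_of_mul_lt_card_of_maps_to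
    (s := F) (t := W ×ˢ W) (f := fun y => (v y, w y)) (n := n)
    (fun y hy => Finset.mk_mem_product (hv y hy) (hw y hy)) (by rwa [Finset.card_product])
  obtain ⟨hv₀, hw₀⟩ := Finset.mem_product.1 hvw
  dsimp only at hv₀ hw₀
  set G := F.filter fun y => (v y, w y) = (v₀, w₀) with hGdef
  have hGF : ∀ y ∈ G, y ∈ F ∧ v y = v₀ ∧ w y = w₀ := fun y hy => by
    simpa [hGdef] using hy
  have hne : ∀ y ∈ G, ∀ y' ∈ G, y ≠ y' → s y ≠ s y' := by
    intro y hy y' hy' hyy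
    obtain ⟨hyF, hyv, hyw⟩ := hGF y hy
    obtain ⟨hyF', hyv', hyw'⟩ := hGF y' hy'
    have a1 := hvo y hyF
    have a2 := hvo y' hyF'
    have a3 := hwo y hyF
    have a4 := hwo y' hyF'
    have a5 := hsv y hyF
    rw [hyv] at a1 a3 a5
    rw [hyv'] at a2 a4
    rw [hyw] at a3
    rw [hyw'] at a4
    exact hT.end_ne hyF hyF' hyy hw₀ a1 a2 (hs y hyF) a3 a4 a5
  have hlt : ∀ y ∈ G, ∀ y' ∈ G, s y < s y' → ℓ < s y' + v₀.length := by
    intro y hy y' hy' hss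
    obtain ⟨hyF, hyv, hyw⟩ := hGF y hy
    obtain ⟨hyF', hyv', hyw'⟩ := hGF y' hy'
    have a3 := hwo y hyF
    have a4 := hwo y' hyF'
    have a5 := hsv y hyF
    rw [hyv] at a3 a5
    rw [hyv'] at a4
    rw [hyw] at a3
    rw [hyw'] at a4
    exact hT.end_gt hyF hyF' hw₀ a3 a4 a5 (by omega)
  have hcard : n ≤ ((G.filter fun y => ℓ < s y + v₀.length).image
      fun y => s y + (v₀.length : ℤ)).card := by
    rw [Finset.card_image_of_injOn]
    · have h6 := Finset.card_filter_add_card_filter_not (s := G) fun y => ℓ < s y + v₀.length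
      have h7 : (G.filter fun y => ¬ ℓ < s y + v₀.length).card ≤ 1 := by
        rw [Finset.card_le_one]
        intro y hy y' hy'
        by_contra hyy
        rw [Finset.mem_filter] at hy hy'
        rcases lt_or_gt_of_ne (hne y hy.1 y' hy'.1 hyy) with hss | hss
        · exact hy'.2 (hlt y hy.1 y' hy'.1 hss)
        · exact hy.2 (hlt y' hy'.1 y hy.1 hss)
      omega
    · intro y hy y' hy' hyy
      by_contra hcon
      refine hne y (Finset.mem_of_mem_filter y hy) y' (Finset.mem_of_mem_filter y' hy') hcon ?_
      exact add_right_cancel hyy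
  let emb := Finset.orderEmbOfCardLe _ hcard
  have hemb : ∀ i, ∃ y ∈ G, ℓ < s y + v₀.length ∧ s y + v₀.length = emb i := by
    intro i
    obtain ⟨y, hy, hyi⟩ := Finset.mem_image.1 (Finset.orderEmbOfCardLe_mem _ hcard i)
    rw [Finset.mem_filter] at hy
    exact ⟨y, hy.1, hy.2, hyi⟩
  choose Y hYG hYℓ hYE using hemb
  have hmono : ∀ i j, i < j → s (Y i) < s (Y j) := by
    intro i j hij
    have := emb.lt_iff_lt.2 hij
    have := hYE i
    have := hYE j
    omega
  have hocc : ∀ i, Occurs v₀ (Y i) (s (Y i)) := fun i => by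
    obtain ⟨hyF, hyv, -⟩ := hGF _ (hYG i)
    have := hvo _ hyF
    rwa [hyv] at this
  have hYF : ∀ i, Y i ∈ F := fun i => (hGF _ (hYG i)).1
  have hv₀R := hT.length_le v₀ hv₀
  rcases Nat.eq_zero_or_pos n with rfl | hn
  · exact ⟨v₀, hv₀, fun _ => 0, fun _ => Classical.choose (Finset.card_pos.1 (Nat.zero_lt_of_lt hF)),
      ⟨by omega, by omega, by omega, by omega, by omega, by omega, by omega, by omega⟩,
      by omega, by omega⟩
  have : NeZero n := ⟨hn.ne'⟩
  refine ⟨v₀, hv₀, fun i => s (Y (Fin.ofNat n i)) + v₀.length, fun i => Y (Fin.ofNat n i),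
    ⟨?_, ?_, ?_, by omega, ?_, ?_, ?_, ?_⟩, fun i _ => hYF _, fun i _ => hYℓ _⟩
  · intro i j hij hj
    have := hmono (Fin.ofNat n i) (Fin.ofNat n j) (by
      simp only [Fin.lt_def, Fin.val_ofNat]
      rwa [Nat.mod_eq_of_lt hj, Nat.mod_eq_of_lt (hij.trans hj)])
    omega
  · intro i _
    exact h2.trans_lt (hYℓ _)
  · intro i _
    have := hs _ (hYF (Fin.ofNat n i))
    omega
  · intro i _ j _ x hx1 hx2
    have := (hocc (Fin.ofNat n i)).eq_of_occurs (hocc (Fin.ofNat n j)) (x := v₀.length - x)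
      (by omega) (by omega)
    simpa only [add_sub_assoc] using this
  · intro i _ j _
    exact hT.agree _ (hYF _) _ (hYF _)
  · intro i hi j hj hij
    refine hT.differ _ (hYF _) _ (hYF _) fun hYY => ?_
    have hfin : Fin.ofNat n i ≠ Fin.ofNat n j := by
      simp only [ne_eq, Fin.ext_iff, Fin.val_ofNat]
      rwa [Nat.mod_eq_of_lt hj, Nat.mod_eq_of_lt hi]
    rcases lt_or_gt_of_ne hfin with hlt | hlt
    · exact (hmono _ _ hlt).ne (by rw [hYY])
    · exact (hmono _ _ hlt).ne (by rw [hYY])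
  · intro i _
    obtain ⟨hyF, hyv, -⟩ := hGF _ (hYG (Fin.ofNat n i))
    refine ⟨b _, hb _ hyF, ?_⟩
    have := ht _ hyF
    rwa [hyv] at this

/-- A tiled family for at most `K` words has a number of members bounded in terms of `K` only. In
the induction step a large subfamily is tiled, on a smaller range, by the short words alone; these
are fewer, because the word that covers `[-m, 0)` is long. -/
theorem exists_card_bound (α : Type*) (K : ℕ) : ∃ N : ℕ, ∀ (W : Finset (List α))
    (m ℓ h H R : ℤ) (F : Finset (ℤ → α)), W.card ≤ K → TiledFamily W m ℓ h H R F →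
      F.card ≤ N := by
  classical
  induction K with
  | zero =>
    refine ⟨0, fun W m ℓ h H R F hW hT => ?_⟩
    by_contra! hF
    obtain ⟨y, hy⟩ := Finset.card_pos.1 hF
    obtain ⟨a, b, ha, hb, ht⟩ := hT.tiles y hy
    have := hT.one_le
    have := hT.le_range
    have := hT.H_pos
    obtain ⟨-, w, hw, -⟩ := ht.exists_tile (p := a) le_rfl (by omega)
    rw [Nat.le_zero, Finset.card_eq_zero] at hW
    simp [hW] at hw
  | succ K ih =>
    obtain ⟨N, hN⟩ := ih
    -- Short words have to follow a common block up to the end of the `r`-th later one; the search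
    -- for such a block takes `q` steps, during which no word length may be passed, and among `n`
    -- ends there are `q + 1` consecutive ones without a word length in between.
    set r := N + 6 with hr
    set q := (K + 1 + 1) * r + 3 with hq
    set n := (K + 1 + 1) * q + 1 with hn
    refine ⟨(K + 1) * (K + 1) * n, fun W m ℓ h H R F hW hT => ?_⟩
    by_contra! hF
    have hℓh := hT.ℓ_le
    have hmℓ := hT.m_le
    have hm := hT.one_le
    have hHR := hT.le_range
    obtain ⟨v, hv, E, Y, hB, hYF, hE⟩ := hT.exists_branchingFamily (n := n)
      (lt_of_le_of_lt (Nat.mul_le_mul_right _ (Nat.mul_le_mul hW hW)) hF)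
    have hvH := hT.length_le v hv
    obtain ⟨s, hs, hseq⟩ := exists_step_eq (K := K + 1) (r := q)
      (f := fun i => (W.filter fun w => (w.length : ℤ) ≤ E i).card)
      (fun s hs => Finset.card_le_card <| Finset.monotone_filter_right _ fun w _ hw => by
        have h1 : (s + 1) * q ≤ (K + 1 + 1) * q := Nat.mul_le_mul_right _ (by omega)
        have h2 : s * q ≤ (s + 1) * q := Nat.mul_le_mul_right _ (by omega)
        exact hw.trans (hB.mono_le h2 (by omega)))
      ((Finset.card_filter_le _ _).trans hW)
    have hsq : (s + 1) * q ≤ (K + 1 + 1) * q := Nat.mul_le_mul_right _ (by omega)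
    have hsq' : (s + 1) * q = s * q + q := by ring
    have hfilter : (W.filter fun w => (w.length : ℤ) ≤ E (s * q)) =
        W.filter fun w => (w.length : ℤ) ≤ E (s * q + q) := by
      refine Finset.eq_of_subset_of_card_le (Finset.monotone_filter_right _ fun w _ hw =>
        hw.trans (hB.mono_le (by omega) (by omega))) ?_
      rw [← hsq']
      exact hseq.ge
    have hB' := hB.window (s * q) (q + 1) (by omega)
    set E' : ℕ → ℤ := fun i => E (s * q + i) with hE'
    set Y' : ℕ → ℤ → α := fun i => Y (s * q + i) with hY'
    have hY'F : ∀ i < q + 1, Y' i ∈ F := fun i hi => hYF _ (by omega)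
    have hℓE : ∀ i < q + 1, ℓ ≤ E' i := fun i hi => (hE _ (by omega)).le
    have hrun : ∀ i < q + 1, ∀ p, 1 ≤ p → p < m → NoRun (Y' i) p ℓ :=
      fun i hi => hT.noRun _ (hY'F i hi)
    obtain ⟨i, hi, c, hc, ht⟩ := hB'.exists_short_tiling (K := K + 1) (r := r) (by omega) hm hℓE
      hrun hW (fun w hw => by
        by_cases hw0 : (w.length : ℤ) ≤ E' 0
        · exact .inl hw0
        · right
          have : ¬ (w.length : ℤ) ≤ E (s * q + q) := fun hlen => hw0 <| by
            have := (Finset.ext_iff.1 hfilter w).2 (Finset.mem_filter.2 ⟨hw, hlen⟩)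
            exact (Finset.mem_filter.1 this).2
          exact (not_le.1 this).le) (fun w hw => by have := hT.length_le w hw; omega)
    set S := W.filter fun w => (w.length : ℤ) ≤ E' 0 with hS
    have hE0 := hB'.lt_end 0 (by omega)
    have hE0v := hB'.end_le 0 (by omega)
    have hSW : S.card ≤ K := by
      have : S.card < W.card := by
        refine Finset.card_lt_card (Finset.filter_ssubset.2 ⟨v, hv, ?_⟩)
        omega
      omega
    have hinj : Set.InjOn (fun j => Y' (i + 3 + j)) (Finset.range (N + 1)) := by
      intro j hj j' hj' hjj
      simp only [Finset.coe_range, Set.mem_Iio] at hj hj'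
      by_contra hne
      obtain ⟨x, -, -, hx⟩ := hB'.differ (i + 3 + j) (by omega) (i + 3 + j') (by omega) (by omega)
      exact hx (congrFun hjj x)
    have hF'F : ∀ y ∈ (Finset.range (N + 1)).image fun j => Y' (i + 3 + j), y ∈ F := by
      intro y hy
      obtain ⟨j, hj, rfl⟩ := Finset.mem_image.1 hy
      rw [Finset.mem_range] at hj
      exact hY'F _ (by omega)
    have := hN S m ℓ h (E' 0) (2 * E' 0) ((Finset.range (N + 1)).image fun j => Y' (i + 3 + j)) hSW
      { one_le := hm
        m_le := hmℓ
        ℓ_le := hℓh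
        H_pos := by omega
        le_length := fun w hw => hT.le_length w (Finset.mem_of_mem_filter w hw)
        length_le := fun w hw => (Finset.mem_filter.1 hw).2
        le_range := le_rfl
        noRun := fun y hy => hT.noRun y (hF'F y hy)
        noRun' := fun y hy => hT.noRun' y (hF'F y hy)
        agree := fun y hy y' hy' x hx1 hx2 => hT.agree y (hF'F y hy) y' (hF'F y' hy') x hx1
          (by omega)
        differ := fun y hy y' hy' => hT.differ y (hF'F y hy) y' (hF'F y' hy')
        tiles := fun y hy => by
          obtain ⟨j, hj, rfl⟩ := Finset.mem_image.1 hy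
          rw [Finset.mem_range] at hj
          exact hB'.tiles_of_short_tiling hm hℓE hrun (k := i + r) (by omega) hc ht
            (fun w hw => (Finset.mem_filter.1 hw).2) (by omega) (by omega) }
    rw [Finset.card_image_of_injOn hinj, Finset.card_range] at this
    omega

end TiledFamily
/-! ### Desubstitutions -/

section Desubstitution

variable {α : Type*} {w : α → List α} {x : ℤ → α} {k : ℤ → ℤ} {y : ℤ → α}

/-- The defining expression maps over integers, obtained from `List.range` by a coercion of lists;
here the map is over natural numbers. -/
theorem factorWord_eq_map (x : ℤ → α) (i j : ℤ) :
    factorWord x i j = (List.range (j - i).toNat).map fun n : ℕ => x (i + n) := by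
  simp [factorWord, ← List.map_eq_flatMap]

theorem factorWord_eq_iff {x : ℤ → α} {i j : ℤ} (hij : i ≤ j) {w : List α} :
    factorWord x i j = w ↔ j = i + w.length ∧ Occurs w x i := by
  constructor
  · rintro rfl
    refine ⟨by simp [factorWord_eq_map, hij], fun n hn => by simp [factorWord_eq_map]⟩
  · rintro ⟨rfl, ho⟩
    refine List.ext_getElem (by simp [factorWord_eq_map]) fun n h1 h2 => ?_
    rw [← ho n h2]
    simp [factorWord_eq_map]

theorem isDesubstitution_iff : IsDesubstitution w x k y ↔
    StrictMono k ∧ ∀ s, k (s + 1) = k s + (w (y s)).length ∧ Occurs (w (y s)) x (k s) :=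
  and_congr_right fun hk => forall_congr' fun s => factorWord_eq_iff (hk (by omega)).le

theorem IsDesubstitution.tiles [DecidableEq (List α)] (h : IsDesubstitution w x k y) {A : Finset α}
    (hy : ∀ s, y s ∈ A) (s : ℤ) (n : ℕ) : Tiles (A.image w) x (k s) (k (s + n)) := by
  obtain ⟨-, hk⟩ := isDesubstitution_iff.1 h
  induction n generalizing s with
  | zero => simpa using Tiles.nil _
  | succ n ih =>
    refine .cons (w (y s)) (Finset.mem_image_of_mem _ (hy s)) (hk s).2 ?_
    rw [← (hk s).1, show s + ((n + 1 : ℕ) : ℤ) = s + 1 + n by push_cast; ring]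
    exact ih _

theorem StrictMono.add_natCast_le {k : ℤ → ℤ} (hk : StrictMono k) (s : ℤ) (n : ℕ) :
    k s + n ≤ k (s + n) := by
  induction n with
  | zero => simp
  | succ n ih =>
    have := hk (show s + n < s + ((n + 1 : ℕ) : ℤ) by push_cast; omega)
    push_cast at *
    omega

theorem IsDesubstitution.exists_tiles [DecidableEq (List α)] (h : IsDesubstitution w x k y)
    {A : Finset α} (hy : ∀ s, y s ∈ A) (a b : ℤ) :
    ∃ a' b', a' ≤ a ∧ b ≤ b' ∧ Tiles (A.image w) x a' b' := by
  have h1 := h.1.add_natCast_le (0 - (k 0 - a).toNat) (k 0 - a).toNat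
  have h2 := h.1.add_natCast_le 0 (b - k 0).toNat
  rw [sub_add_cancel] at h1
  refine ⟨k (0 - (k 0 - a).toNat), k (0 + (b - k 0).toNat), by omega, by omega, ?_⟩
  have := h.tiles hy (0 - (k 0 - a).toNat) ((k 0 - a).toNat + (b - k 0).toNat)
  convert this using 2
  push_cast
  ring

/-- The cutting points can be renumbered so that the zeroth block contains the origin. -/
theorem IsDesubstitution.exists_normalized (h : IsDesubstitution w x k y) :
    ∃ d, k d ≤ 0 ∧ 0 < k (d + 1) := by
  have h1 := h.1.add_natCast_le (0 - (k 0).toNat) (k 0).toNat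
  rw [sub_add_cancel] at h1
  obtain ⟨d, hd, hmax⟩ := Int.exists_greatest_of_bdd (P := fun d => k d ≤ 0) ⟨(0 - k 0).toNat, by
    intro z hz
    by_contra! hlt
    have h2 := h.1.add_natCast_le 0 (0 - k 0).toNat
    have h3 := h.1 hlt
    rw [zero_add] at h2
    omega⟩ ⟨_, show k (0 - (k 0).toNat) ≤ 0 by omega⟩
  exact ⟨d, hd, by
    by_contra! hle
    have := hmax _ hle
    omega⟩

/-- For a given substitution, the configurations with a desubstitution over a finite alphabet form
a compact set. -/
theorem isCompact_setOf_desubstitution [TopologicalSpace α] [DiscreteTopology α] (A : Finset α)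
    (w : α → List α) :
    IsCompact {x : ℤ → α | ∃ k y, (∀ s, y s ∈ A) ∧ IsDesubstitution w x k y} := by
  classical
  set H : ℕ := A.sup fun a => (w a).length with hH
  have hle : ∀ a ∈ A, (w a).length ≤ H := fun a ha => Finset.le_sup (f := fun a => (w a).length) ha
  set B : Finset α := A.biUnion fun a => (w a).toFinset with hB
  -- The triples `(k, y, x)` with `k` normalised by `k 0 ≤ 0 < k 1` form a closed subset of a
  -- product of finite sets.
  set P : Set ((ℤ → ℤ) × (ℤ → α) × (ℤ → α)) :=
    (Set.univ.pi fun s : ℤ => Set.Icc (-(H * (|s| + 1) : ℤ)) (H * (|s| + 1))) ×ˢ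
      ((Set.univ.pi fun _ : ℤ => (A : Set α)) ×ˢ (Set.univ.pi fun _ : ℤ => (B : Set α))) with hP
  have hPc : IsCompact P := by
    refine IsCompact.prod (isCompact_univ_pi fun s => (Set.finite_Icc _ _).isCompact)
      (IsCompact.prod (isCompact_univ_pi fun s => A.finite_toSet.isCompact)
        (isCompact_univ_pi fun s => B.finite_toSet.isCompact))
  set Q : Set ((ℤ → ℤ) × (ℤ → α) × (ℤ → α)) :=
    {q | ∀ s, q.1 s < q.1 (s + 1) ∧ q.1 (s + 1) = q.1 s + (w (q.2.1 s)).length ∧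
      Occurs (w (q.2.1 s)) q.2.2 (q.1 s)} with hQ
  have hQc : IsClosed Q := by
    have hQ' : Q = ⋂ s, {q : (ℤ → ℤ) × (ℤ → α) × (ℤ → α) | q.1 s < q.1 (s + 1) ∧
        q.1 (s + 1) = q.1 s + (w (q.2.1 s)).length ∧ Occurs (w (q.2.1 s)) q.2.2 (q.1 s)} := by
      ext q; simp [hQ]
    rw [hQ']
    refine isClosed_iInter fun s => ?_
    have c1 : Continuous fun q : (ℤ → ℤ) × (ℤ → α) × (ℤ → α) => q.1 s := by fun_prop
    have c2 : Continuous fun q : (ℤ → ℤ) × (ℤ → α) × (ℤ → α) => q.1 (s + 1) := by fun_prop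
    have c3 : Continuous fun q : (ℤ → ℤ) × (ℤ → α) × (ℤ → α) => q.2.1 s := by fun_prop
    have c4 : Continuous fun q : (ℤ → ℤ) × (ℤ → α) × (ℤ → α) => (w (q.2.1 s)).length :=
      continuous_of_discreteTopology.comp c3 (g := fun a => (w a).length)
    have c5 : ∀ n : ℤ, Continuous fun q : (ℤ → ℤ) × (ℤ → α) × (ℤ → α) => q.2.2 n := by
      intro n; fun_prop
    have hocc : {q : (ℤ → ℤ) × (ℤ → α) × (ℤ → α) | Occurs (w (q.2.1 s)) q.2.2 (q.1 s)} =
        ⋂ (i : ℤ) (a : α) (n : ℕ) (h : n < (w a).length),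
          {q | q.1 s = i ∧ q.2.1 s = a → q.2.2 (i + n) = (w a)[n]} := by
      ext ⟨k, y, x⟩
      simp only [Set.mem_ofPred_eq, Set.mem_iInter, Occurs]
      constructor
      · rintro h i a n hn ⟨rfl, rfl⟩
        exact h n hn
      · intro h n hn
        exact h _ _ n hn ⟨rfl, rfl⟩
    refine IsClosed.inter ?_ (IsClosed.inter ?_ ?_)
    · exact (isClosed_discrete {p : ℤ × ℤ | p.1 < p.2}).preimage (c1.prodMk c2)
    · exact isClosed_eq c2 (c1.add (continuous_of_discreteTopology.comp c4 (g := Nat.cast)))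
    · change IsClosed {q : (ℤ → ℤ) × (ℤ → α) × (ℤ → α) | Occurs (w (q.2.1 s)) q.2.2 (q.1 s)}
      rw [hocc]
      refine isClosed_iInter fun i => isClosed_iInter fun a => isClosed_iInter fun n =>
        isClosed_iInter fun hn => ?_
      exact (isClosed_discrete {p : ℤ × α × α | p.1 = i ∧ p.2.1 = a → p.2.2 = (w a)[n]}).preimage
        (c1.prodMk (c3.prodMk (c5 (i + n))))
  convert (hPc.inter_right hQc).image (f := fun q => q.2.2) (by fun_prop) using 1
  ext x
  simp only [Set.mem_ofPred_eq, Set.mem_image]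
  constructor
  · rintro ⟨k, y, hy, hd⟩
    obtain ⟨d, hd0, hd1⟩ := hd.exists_normalized
    obtain ⟨hk, hd'⟩ := isDesubstitution_iff.1 hd
    refine ⟨(fun s => k (s + d), fun s => y (s + d), x), ⟨⟨?_, ?_, ?_⟩, ?_⟩, rfl⟩
    · have hstep : ∀ s, k (s + 1) ≤ k s + H ∧ k s ≤ k (s + 1) := fun s => by
        have h1 := (hd' s).1
        have h2 := hle _ (hy s)
        have h3 := hk (show s < s + 1 by omega)
        omega
      have h0 := hstep d
      have hbound : ∀ n : ℕ, k (d + n) ≤ H * n ∧ -(H * (n + 1) : ℤ) ≤ k (d + n) ∧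
          -(H * (n + 1) : ℤ) ≤ k (d - n) ∧ k (d - n) ≤ H * n := by
        intro n
        induction n with
        | zero => simp; omega
        | succ n ih =>
          have h1 := hstep (d + n)
          have h2 := hstep (d - (n + 1))
          rw [show d - (n + 1 : ℤ) + 1 = d - n by ring] at h2
          push_cast
          rw [← add_assoc]
          have e1 : (H : ℤ) * (n + 1 + 1) = H * (n + 1) + H := by ring
          have e2 : (H : ℤ) * (n + 1) = H * n + H := by ring
          omega
      intro s _
      have := hbound s.natAbs
      have e2 : (H : ℤ) * (|s| + 1) = H * |s| + H := by ring
      simp only [Set.mem_Icc]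
      rcases le_total 0 s with hs | hs
      · rw [show (s.natAbs : ℤ) = |s| by simp] at this
        rw [abs_of_nonneg hs] at *
        rw [add_comm s d]
        omega
      · rw [show (s.natAbs : ℤ) = |s| by simp] at this
        rw [abs_of_nonpos hs, sub_neg_eq_add] at *
        rw [add_comm s d]
        omega
    · exact fun s _ => hy _
    · intro i _
      obtain ⟨a, b, ha, hb, ht⟩ := hd.exists_tiles hy i (i + 1)
      obtain ⟨s, v, hv, ho, hs, hs', -⟩ := ht.exists_tile (p := i) ha (by omega)
      obtain ⟨c, hc, rfl⟩ := Finset.mem_image.1 hv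
      have := ho (i - s).toNat (by omega)
      rw [show s + ((i - s).toNat : ℤ) = i by omega] at this
      simp only [hB, Finset.coe_biUnion, Set.mem_iUnion]
      exact ⟨c, hc, by rw [this]; simp⟩
    · intro s
      have := hd' (s + d)
      have h1 := hk (show s + d < s + d + 1 by omega)
      rw [show s + d + 1 = s + 1 + d by ring] at this h1
      exact ⟨h1, this⟩
  · rintro ⟨⟨k, y, x⟩, ⟨⟨-, hy, -⟩, hq⟩, rfl⟩
    refine ⟨k, y, fun s => hy s trivial, isDesubstitution_iff.2
      ⟨strictMono_int_of_lt_succ fun s => (hq s).1, fun s => (hq s).2⟩⟩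

end Desubstitution

/-! ### The limit set -/

theorem shift_iterate {α : Type*} (x : ℤ → α) (n : ℕ) (i : ℤ) :
    (shift^[n] x) i = x (i + n) := by
  induction n generalizing i with
  | zero => simp
  | succ n ih =>
    rw [Function.iterate_succ_apply', shift, ih]
    congr 1
    push_cast
    ring

namespace DirectiveSequence

variable {α : Type*} (τ : DirectiveSequence α)

theorem coe_shiftMap_iterate (x : τ.limitSet) (n : ℕ) :
    ((τ.shiftMap^[n] x : τ.limitSet) : ℤ → α) = shift^[n] x := by
  induction n with
  | zero => rfl
  | succ n ih => rw [Function.iterate_succ_apply', Function.iterate_succ_apply', ← ih]; rfl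

theorem isCompact_limitSet [TopologicalSpace α] [DiscreteTopology α] : IsCompact τ.limitSet := by
  have : τ.limitSet = ⋂ t, {x : ℤ → α | ∃ k y, (∀ s, y s ∈ τ.alphabet t) ∧
      IsDesubstitution (τ.comp t) x k y} := by
    ext x; simp [limitSet]
  rw [this]
  exact (isCompact_setOf_desubstitution _ _).of_isClosed_subset
    (isClosed_iInter fun t => (isCompact_setOf_desubstitution _ _).isClosed)
    (Set.iInter_subset _ 0)

/-- The limit set is invariant under all powers of the shift, negative ones included. -/
theorem translate_mem_limitSet {x : ℤ → α} (hx : x ∈ τ.limitSet) (d : ℤ) :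
    (fun i => x (i + d)) ∈ τ.limitSet := by
  intro t
  obtain ⟨k, y, hy, h⟩ := hx t
  obtain ⟨hk, h'⟩ := isDesubstitution_iff.1 h
  refine ⟨fun s => k s - d, y, hy, isDesubstitution_iff.2 ⟨fun a b hab => by
    simpa using hk hab, fun s => ⟨by have := (h' s).1; omega, fun n hn => ?_⟩⟩⟩
  rw [← (h' s).2 n hn]
  change x (k s - d + n + d) = _
  congr 1
  ring

/-- In the absence of periodic points, runs of a given period have bounded length. -/
theorem exists_noRun [TopologicalSpace α] [DiscreteTopology α]
    (haper : Function.periodicPts τ.shiftMap = ∅) {p : ℕ} (hp : 0 < p) :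
    ∃ L : ℕ, ∀ y ∈ τ.limitSet, NoRun y p L := by
  by_contra! hcon
  have hclosed : ∀ L : ℕ, IsClosed {y : ℤ → α | ∀ x : ℤ, -L ≤ x → x < L → y x = y (x + p)} := by
    intro L
    have : {y : ℤ → α | ∀ x : ℤ, -L ≤ x → x < L → y x = y (x + p)} =
        ⋂ (x : ℤ) (_ : -L ≤ x) (_ : x < L), {y | y x = y (x + p)} := by
      ext y; simp
    rw [this]
    exact isClosed_iInter fun x => isClosed_iInter fun _ => isClosed_iInter fun _ =>
      isClosed_eq (by fun_prop) (by fun_prop)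
  have hne := IsCompact.nonempty_iInter_of_sequence_nonempty_isCompact_isClosed
    (fun L : ℕ => τ.limitSet ∩ {y | ∀ x : ℤ, -L ≤ x → x < L → y x = y (x + p)})
    (fun L y hy => ⟨hy.1, fun x h1 h2 => hy.2 x (by push_cast; omega) (by push_cast; omega)⟩)
    (fun L => by
      obtain ⟨y, hy, hrun⟩ := hcon (2 * L)
      obtain ⟨a, ha⟩ := not_forall.1 hrun
      rw [not_not] at ha
      refine ⟨_, τ.translate_mem_limitSet hy (a + L), fun x h1 h2 => ?_⟩
      rw [ha (x + (a + L)) (by omega) (by push_cast; omega)]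
      congr 1
      ring)
    (τ.isCompact_limitSet.inter_right (hclosed 0))
    (fun L => (τ.isCompact_limitSet.inter_right (hclosed L)).isClosed)
  obtain ⟨y, hy⟩ := hne
  simp only [Set.mem_iInter, Set.mem_inter_iff, Set.mem_ofPred_eq] at hy
  have hmem : (⟨y, (hy 0).1⟩ : τ.limitSet) ∈ Function.periodicPts τ.shiftMap := by
    refine ⟨p, hp, Subtype.ext ?_⟩
    rw [coe_shiftMap_iterate]
    funext i
    rw [shift_iterate]
    exact ((hy (i.natAbs + 1)).2 i (by omega) (by omega)).symm
  rw [haper] at hmem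
  exact hmem

theorem exists_noRun_le [TopologicalSpace α] [DiscreteTopology α]
    (haper : Function.periodicPts τ.shiftMap = ∅) (q : ℕ) :
    ∃ L : ℕ, q ≤ L ∧ ∀ y ∈ τ.limitSet, ∀ p : ℤ, 1 ≤ p → p ≤ q → NoRun y p L := by
  have := fun p : ℕ => τ.exists_noRun haper (p := p + 1) (by omega)
  choose f hf using this
  refine ⟨q + (Finset.range q).sup f, by omega, fun y hy p hp hpq a ha => ?_⟩
  have hle : f (p - 1).toNat ≤ (Finset.range q).sup f :=
    Finset.le_sup (Finset.mem_range.2 (by omega))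
  refine hf (p - 1).toNat y hy a fun x h1 h2 => ?_
  rw [ha x h1 (by push_cast; omega)]
  congr 1
  omega

/-- The only consequence of preperiodicity that matters here: the alphabets have bounded size. -/
theorem exists_card_alphabet_le (hpre : τ.IsPreperiodic) :
    ∃ K, ∀ t, (τ.alphabet t).card ≤ K := by
  obtain ⟨q, p, hp, h⟩ := hpre
  refine ⟨(Finset.range (q + p)).sup fun t => (τ.alphabet t).card, fun t => ?_⟩
  induction t using Nat.strong_induction_on with
  | _ t ih =>
    by_cases ht : t < q + p
    · exact Finset.le_sup (f := fun t => (τ.alphabet t).card) (Finset.mem_range.2 ht)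
    · have := (h (t - p) (by omega)).1
      rw [Nat.sub_add_cancel (by omega)] at this
      rw [this]
      exact ih _ (by omega)

/-- The number of points of the limit set with a given right half is bounded, as soon as the
alphabets have bounded size. -/
theorem exists_card_le_of_agree [TopologicalSpace α] [DiscreteTopology α] {K : ℕ}
    (hK : ∀ t, (τ.alphabet t).card ≤ K) (hgrow : τ.EverywhereGrowing)
    (haper : Function.periodicPts τ.shiftMap = ∅) :
    ∃ N : ℕ, ∀ F : Finset (ℤ → α), (∀ y ∈ F, y ∈ τ.limitSet) →
      (∀ y ∈ F, ∀ y' ∈ F, ∀ x : ℤ, 0 ≤ x → y x = y' x) → F.card ≤ N := by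
  classical
  obtain ⟨N, hN⟩ := TiledFamily.exists_card_bound α K
  refine ⟨N, fun F hF hagree => ?_⟩
  have hdiff : ∀ q : (ℤ → α) × (ℤ → α), ∃ d : ℕ, q.1 ∈ F → q.2 ∈ F → q.1 ≠ q.2 →
      ∃ x : ℤ, -d ≤ x ∧ x < 0 ∧ q.1 x ≠ q.2 x := by
    rintro ⟨y, y'⟩
    by_cases h : y ∈ F ∧ y' ∈ F ∧ y ≠ y'
    · obtain ⟨x, hx⟩ := Function.ne_iff.1 h.2.2
      have : x < 0 := by
        by_contra! h0
        exact hx (hagree y h.1 y' h.2.1 x h0)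
      exact ⟨x.natAbs, fun _ _ _ => ⟨x, by omega, this, hx⟩⟩
    · exact ⟨0, fun h1 h2 h3 => absurd ⟨h1, h2, h3⟩ h⟩
  choose d hd using hdiff
  -- `m` bounds the distance from the origin to places where members of `F` differ. The bounds `ℓ`
  -- and `h` on runs depend on `m`, and the level `t` is chosen last.
  set m : ℕ := (F ×ˢ F).sup d + 1 with hm
  obtain ⟨ℓ, hmℓ, hℓ⟩ := τ.exists_noRun_le haper m
  obtain ⟨h, hℓh, hh⟩ := τ.exists_noRun_le haper (ℓ + m)
  obtain ⟨t, ht⟩ := (hgrow.eventually_ge_atTop (h + m)).exists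
  have hlen : ∀ a ∈ τ.alphabet t, h + m ≤ (τ.comp t a).length := fun a ha =>
    ht.trans (Finset.inf'_le _ ha)
  set H : ℕ := (τ.alphabet t).sup (fun a => (τ.comp t a).length) + 1 with hH
  refine hN ((τ.alphabet t).image (τ.comp t)) m ℓ h H (2 * H) F
    (Finset.card_image_le.trans (hK t))
    { one_le := by omega
      m_le := by omega
      ℓ_le := by omega
      H_pos := by omega
      le_length := ?_
      length_le := ?_
      le_range := le_rfl
      noRun := fun y hy p h1 h2 => hℓ y (hF y hy) p h1 h2.le
      noRun' := fun y hy p h1 h2 => hh y (hF y hy) p h1 (by push_cast; exact h2)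
      agree := fun y hy y' hy' x h0 _ => hagree y hy y' hy' x h0
      differ := ?_
      tiles := ?_ }
  · intro w hw
    obtain ⟨a, ha, rfl⟩ := Finset.mem_image.1 hw
    exact_mod_cast hlen a ha
  · intro w hw
    obtain ⟨a, ha, rfl⟩ := Finset.mem_image.1 hw
    have := Finset.le_sup (f := fun a => (τ.comp t a).length) ha
    omega
  · intro y hy y' hy' hne
    obtain ⟨x, h1, h2, h3⟩ := hd (y, y') hy hy' hne
    have : d (y, y') ≤ (F ×ˢ F).sup d := Finset.le_sup (Finset.mk_mem_product hy hy')
    exact ⟨x, by omega, h2, h3⟩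
  · intro y hy
    obtain ⟨k, z, hz, hdes⟩ := hF y hy t
    exact hdes.exists_tiles hz _ _

end DirectiveSequence

/-- On a compact space, points that are close enough for a given metric have the same image under
a continuous map to a discrete space. -/
theorem exists_dist_lt_imp_eq {X β : Type*} [tX : TopologicalSpace X] [CompactSpace X]
    [TopologicalSpace β] [DiscreteTopology β] {f : X → β} (hf : Continuous f) [m : MetricSpace X]
    (hm : m.toPseudoMetricSpace.toUniformSpace.toTopologicalSpace = tX) :
    ∃ ε > 0, ∀ x y : X, dist x y < ε → f x = f y := by
  subst hm
  obtain ⟨ε, hε, h⟩ := lebesgue_number_lemma_of_metric (s := Set.univ) (c := fun b => f ⁻¹' {b})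
    isCompact_univ (fun b => (isOpen_discrete _).preimage hf)
    fun x _ => Set.mem_iUnion.2 ⟨f x, rfl⟩
  refine ⟨ε, hε, fun x y hxy => ?_⟩
  obtain ⟨b, hb⟩ := h x trivial
  have h1 : f x = b := hb (Metric.mem_ball_self hε)
  have h2 : f y = b := hb (Metric.mem_ball'.2 hxy)
  rw [h1, h2]

/-- `m` ranges over all metrics on the limit set which induce its topology as a subspace of the
product `α^ℤ` of discrete spaces. -/
theorem corollaryc {α : Type*} [TopologicalSpace α] [DiscreteTopology α]
    (τ : DirectiveSequence α) (hpre : τ.IsPreperiodic) (hgrow : τ.EverywhereGrowing)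
    (haper : Function.periodicPts τ.shiftMap = ∅) [m : MetricSpace τ.limitSet]
    (hm : m.toPseudoMetricSpace.toUniformSpace.toTopologicalSpace =
      (instTopologicalSpaceSubtype : TopologicalSpace τ.limitSet)) :
    IsFinitelyPositivelyExpansive τ.shiftMap := by
  classical
  obtain ⟨K, hK⟩ := τ.exists_card_alphabet_le hpre
  obtain ⟨N, hN⟩ := τ.exists_card_le_of_agree hK hgrow haper
  have hcompact := isCompact_iff_compactSpace.1 τ.isCompact_limitSet
  obtain ⟨ε, hε, hdist⟩ := exists_dist_lt_imp_eq (tX := instTopologicalSpaceSubtype)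
    (f := fun x : τ.limitSet => (x : ℤ → α) 0)
    (by exact (continuous_apply 0).comp continuous_subtype_val) hm
  refine ⟨N + 1, by omega, ε, hε, fun x => ?_⟩
  have hball : ∀ y ∈ dynamicalBall τ.shiftMap ε x, ∀ i : ℤ, 0 ≤ i →
      (y : ℤ → α) i = (x : ℤ → α) i := by
    intro y hy i hi
    lift i to ℕ using hi
    have := hdist _ _ (hy i)
    rw [τ.coe_shiftMap_iterate, τ.coe_shiftMap_iterate, shift_iterate, shift_iterate] at this
    simpa using this.symm
  by_contra! hlt
  obtain ⟨s, hs, hcard⟩ := Set.exists_subset_encard_eq hlt.le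
  have hfin : s.Finite := Set.finite_of_encard_eq_coe hcard
  have h1 : hfin.toFinset.card = N + 1 := by
    rw [hfin.encard_eq_coe_toFinset_card] at hcard
    exact_mod_cast hcard
  have h2 := hN (hfin.toFinset.image Subtype.val)
    (fun y hy => by
      obtain ⟨z, -, rfl⟩ := Finset.mem_image.1 hy
      exact z.2)
    (fun y hy y' hy' i hi => by
      obtain ⟨z, hz, rfl⟩ := Finset.mem_image.1 hy
      obtain ⟨z', hz', rfl⟩ := Finset.mem_image.1 hy'
      rw [hball z (hs (hfin.mem_toFinset.1 hz)) i hi, hball z' (hs (hfin.mem_toFinset.1 hz')) i hi])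
  rw [Finset.card_image_of_injective _ Subtype.val_injective, h1] at h2
  omega
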